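/- Let $n\ge 0$ be an integer and let $\mathcal P_{2n}$ be the space of positive definite symmetric real $2n\times 2n$ matrices $X=(X_{ij})$, an open subset of the space of all symmetric matrices. Let $\mathrm dX=(\mathrm dX_{ij})$, and consider on $\mathcal P_{2n}$ the differential forms $$\beta_X^{4k+1}=\operatorname{tr}\big((X^{-1}\,\mathrm dX)^{4k+1}\big)\ (k\ge 1),\qquad \phi_X=\frac{1}{\sqrt{\det X}}\,\operatorname{Pf}\big(\mathrm dX\cdot X^{-1}\cdot \mathrm dX\big),$$ where $\sqrt{\det X}>0$ and $$\operatorname{Pf}(M)=\frac{1}{2^n n!}\sum_{\pi\in\mathfrak S_{2n}}\operatorname{sgn}(\pi)\,M_{\pi(1)\pi(2)}\cdots M_{\pi(2n-1)\pi(2n)}.$$ Let $\Omega_{\mathrm{can}}=\bigwedge^\bullet\big(\bigoplus_{k\ge1}\mathbb Q\,\beta^{4k+1}\big)$ be the algebra of canonical forms, and let $\omega\mapsto\omega_X$ be the $\mathbb Q$-algebra homomorphism from $\Omega_{\mathrm{can}}$ to differential forms on $\mathcal P_{2n}$ that sends $\beta^{4k+1}$ to $\beta^{4k+1}_X$. **Theorem.**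 For every $\omega\in\Omega_{\mathrm{can}}$ there is a polynomial form $Q_\omega$, i.e. an element of the $\mathbb Q$-algebra of differential forms on the space of symmetric matrices generated by the entries $X_{ij}$ and their differentials $\mathrm dX_{ij}$, such that for all $X\in\mathcal P_{2n}$ $$\omega_X\wedge\phi_X=\frac{Q_\omega(X)}{(\det X)^{n+1/2}}.$$ That is, the pole of $\omega_X\wedge\phi_X$ along $\det X=0$ has order at most $n+1/2$. -/

import Mathlib

namespace PfaffianForms

noncomputable section

/-- The real vector space of symmetric `m × m` matrices. -/
def SymMat (m : ℕ) : Submodule ℝ (Matrix (Fin m) (Fin m) ℝ) where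
  carrier := {X | X.transpose = X}
  add_mem' := by
    intro X Y hX hY
    simp only [Set.mem_ofPred_eq] at hX hY ⊢
    rw [Matrix.transpose_add, hX, hY]
  zero_mem' := Matrix.transpose_zero
  smul_mem' := by
    intro c X hX
    simp only [Set.mem_ofPred_eq] at hX ⊢
    rw [Matrix.transpose_smul, hX]

/-- The space of positive definite symmetric real `m × m` matrices, an open subset
of the vector space `SymMat m`. -/
def SPD (m : ℕ) : Type := {X : SymMat m // (X : Matrix (Fin m) (Fin m) ℝ).PosDef}

/-- The underlying matrix of a point of `SPD m`. -/
def SPD.mat {m : ℕ} (X : SPD m) : Matrix (Fin m) (Fin m) ℝ := X.1.1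

/-- The exterior algebra on the cotangent space of `SymMat m` at any of its points. Since `SymMat m`
is a vector space, that cotangent space is the dual of `SymMat m`. The product is the
wedge product. A differential form on a subset `U` of `SymMat m` is a function `U → Forms m`;
sums and wedge products of such functions are pointwise. -/
abbrev Forms (m : ℕ) : Type := ExteriorAlgebra ℝ (Module.Dual ℝ (SymMat m))

/-- The coordinate function `X ↦ X i j`, a linear functional on `SymMat m`. -/
def coord (m : ℕ) (i j : Fin m) : Module.Dual ℝ (SymMat m) where
  toFun X := (X : Matrix (Fin m) (Fin m) ℝ) i j
  map_add' _ _ := rfl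
  map_smul' _ _ := rfl

/-- The matrix of one-forms `dX`; its entry `dX i j` is the differential of the linear function
`X ↦ X i j`, which at every point is that function itself. -/
def dX (m : ℕ) : Matrix (Fin m) (Fin m) (Forms m) :=
  Matrix.of fun i j => ExteriorAlgebra.ι ℝ (coord m i j)

/-- A real matrix viewed as a matrix of forms of degree zero. -/
def const {m : ℕ} (A : Matrix (Fin m) (Fin m) ℝ) : Matrix (Fin m) (Fin m) (Forms m) :=
  A.map (algebraMap ℝ (Forms m))

/-- The primitive form `β^{4k+1} = tr ((X⁻¹ dX)^{4k+1})` on `SPD m`. -/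
def beta (m k : ℕ) : SPD m → Forms m := fun X =>
  ((const X.mat⁻¹ * dX m) ^ (4 * k + 1)).trace

/-- The Pfaffian `1/(2^n n!) ∑_π sgn π ∏_i M_{π(2i-1) π(2i)}` of a `2n × 2n` matrix. The factors are
multiplied in the order of increasing `i`; the order is irrelevant when the entries commute,
as they do for matrices of two-forms. -/
def pfaffian {R : Type*} [Ring R] [Algebra ℝ R] (n : ℕ)
    (M : Matrix (Fin (2 * n)) (Fin (2 * n)) R) : R :=
  ((2 : ℝ) ^ n * (n.factorial : ℝ))⁻¹ •
    ∑ π : Equiv.Perm (Fin (2 * n)), (Equiv.Perm.sign π : ℤ) •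
      (List.ofFn fun i : Fin n =>
        M (π ⟨2 * (i : ℕ), by omega⟩) (π ⟨2 * (i : ℕ) + 1, by omega⟩)).prod

/-- The Pfaffian form `φ_X = (det X)^{-1/2} Pf (dX · X⁻¹ · dX)` on `SPD (2 * n)`. -/
def pfaffianForm (n : ℕ) : SPD (2 * n) → Forms (2 * n) := fun X =>
  (Real.sqrt X.mat.det)⁻¹ • pfaffian n (dX (2 * n) * const X.mat⁻¹ * dX (2 * n))

/-- The algebra of canonical forms: the exterior algebra over `ℚ` on generators
`β^{4k+1}`, one for each `k ≥ 1`. -/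
abbrev CanonicalForms : Type := ExteriorAlgebra ℚ (ℕ+ →₀ ℚ)

section Odd

variable {V : Type*} [AddCommGroup V] [Module ℝ V]

theorem mul_eq_involute_mul (y : ExteriorAlgebra ℝ V)
    (h : ∀ v : V, y * ExteriorAlgebra.ι ℝ v = -(ExteriorAlgebra.ι ℝ v * y))
    (x : ExteriorAlgebra ℝ V) : y * x = CliffordAlgebra.involute x * y := by
  induction x using ExteriorAlgebra.induction with
  | algebraMap r =>
    rw [AlgHom.commutes]
    exact (Algebra.commutes r y).symm
  | ι v =>
    rw [h v, ← neg_mul]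
    exact congrArg (· * y) (CliffordAlgebra.involute_ι (Q := (0 : QuadraticForm ℝ V)) v).symm
  | mul a b ha hb => rw [map_mul, ← mul_assoc, ha, mul_assoc, hb, mul_assoc]
  | add a b ha hb => rw [map_add, mul_add, add_mul, ha, hb]

/-- Forms of odd degree square to zero. -/
theorem mul_self_eq_zero_of_odd (y : ExteriorAlgebra ℝ V)
    (hy : CliffordAlgebra.involute y = -y) : y * y = 0 := by
  have h1 : ∀ v : V, y * ExteriorAlgebra.ι ℝ v = -(ExteriorAlgebra.ι ℝ v * y) := by
    intro v
    have := mul_eq_involute_mul (ExteriorAlgebra.ι ℝ v)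
      (fun w => eq_neg_of_add_eq_zero_left (ExteriorAlgebra.ι_add_mul_swap v w)) y
    rw [this, hy, neg_mul, neg_neg]
  have h2 := mul_eq_involute_mul y h1 y
  rw [hy, neg_mul] at h2
  have h3 : (2 : ℝ) • (y * y) = 0 := by
    rw [two_smul]
    nth_rewrite 1 [h2]
    exact neg_add_cancel _
  exact (smul_eq_zero.mp h3).resolve_left two_ne_zero

end Odd

theorem involute_beta (m k : ℕ) (X : SPD m) :
    CliffordAlgebra.involute (beta m k X) = -beta m k X := by
  have h : (const X.mat⁻¹ * dX m).map
      (CliffordAlgebra.involute (Q := (0 : QuadraticForm ℝ (Module.Dual ℝ (SymMat m))))) =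
      -(const X.mat⁻¹ * dX m) := by
    ext i j
    simp only [Matrix.map_apply, Matrix.mul_apply, Matrix.neg_apply, map_sum, map_mul, const, dX,
      Matrix.of_apply, AlgHom.commutes, ← Finset.sum_neg_distrib]
    refine Finset.sum_congr rfl fun l _ => ?_
    rw [← mul_neg]
    exact congrArg _ (CliffordAlgebra.involute_ι _)
  have h2 := map_pow (AlgHom.mapMatrix (m := Fin m)
    (CliffordAlgebra.involute (Q := (0 : QuadraticForm ℝ (Module.Dual ℝ (SymMat m))))))
    (const X.mat⁻¹ * dX m) (4 * k + 1)
  rw [AlgHom.mapMatrix_apply, AlgHom.mapMatrix_apply, h,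
    Odd.neg_pow ⟨2 * k, by ring⟩] at h2
  have h3 := congrArg Matrix.trace h2
  rw [Matrix.trace_neg] at h3
  rw [beta, ← h3]
  simp only [Matrix.trace, Matrix.diag_apply, map_sum, Matrix.map_apply]

/-- The linear map sending the generator `β^{4k+1}` to the differential form `β^{4k+1}_X`. -/
def betaLin (m : ℕ) : (ℕ+ →₀ ℚ) →ₗ[ℚ] (SPD m → Forms m) :=
  Finsupp.linearCombination ℚ fun k : ℕ+ => beta m (k : ℕ)

theorem betaLin_mul_self (m : ℕ) (v : ℕ+ →₀ ℚ) : betaLin m v * betaLin m v = 0 := by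
  funext X
  refine mul_self_eq_zero_of_odd _ ?_
  simp only [betaLin, Finsupp.linearCombination_apply, Finsupp.sum, Finset.sum_apply,
    Pi.smul_apply, map_sum, ← Finset.sum_neg_distrib]
  refine Finset.sum_congr rfl fun k _ => ?_
  rw [map_rat_smul, involute_beta, smul_neg]

/-- The algebra homomorphism `ω ↦ ω_X` from the algebra of canonical forms to differential forms
on `SPD m`, sending the generator `β^{4k+1}` to `β^{4k+1}_X`. -/
def realize (m : ℕ) : CanonicalForms →ₐ[ℚ] (SPD m → Forms m) :=
  ExteriorAlgebra.lift ℚ ⟨betaLin m, betaLin_mul_self m⟩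

/-- The algebra of polynomial forms `ℚ[X i j, dX i j]` on `SymMat m`: the `ℚ`-algebra of
differential forms generated by the matrix entries (functions, i.e. forms of degree zero) and their
differentials (constant one-forms). -/
def polynomialForms (m : ℕ) : Subalgebra ℚ (SymMat m → Forms m) :=
  Algebra.adjoin ℚ
    ((Set.range fun p : Fin m × Fin m => fun X : SymMat m =>
        algebraMap ℝ (Forms m) ((X : Matrix (Fin m) (Fin m) ℝ) p.1 p.2)) ∪
     (Set.range fun p : Fin m × Fin m => fun _ : SymMat m => dX m p.1 p.2))

end

end PfaffianForms

/-! Up to the factor `(det X)^{-1/2}`, the form in question is `A = ω_X ∧ Pf(dX X⁻¹ dX)`, and `det^N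
· A = Q` is polynomial for some large `N`. The point is to divide `Q` by `det^(N - n)`.

At `X = U D² Uᵀ` with `U` orthogonal and `D = diag σ`, put `S = D⁻¹ (Uᵀ dX U) D⁻¹`. Then `X⁻¹ dX` is
conjugate to `S`, and `dX X⁻¹ dX = (U D) S² (D Uᵀ)`, so every denominator in `A` comes from an entry
`(σ i σ j)⁻¹ (Uᵀ dX U) i j`. One-forms square to zero, so a monomial uses each pair `i ≤ j` at most
once, and `(∏ σ i)^(2n+1)` clears all denominators (`scaledForms_bound`). Since `Q` depends on `σ`
only through the `σ i ^ 2`, parity improves the resulting pole order of `A` from `n + 1/2` to `n`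
(`prod_X_pow_dvd`).

This is divisibility on each slice `U diag(x) Uᵀ`. To obtain one polynomial quotient with rational
coefficients, `exists_div_mod` divides `Q(X + τ)` by the power `N - n` of the monic polynomial
`det(X + τ)` in `τ`. Slice divisibility makes the remainder vanish, and `τ = 0` gives the quotient.
-/

namespace PfaffianForms

noncomputable section

/-! ### Closure of algebras of functions under matrix operations, traces and Pfaffians -/

section Entries

variable {α R ι : Type*} [Ring R] [Algebra ℚ R] [Fintype ι] (S : Subalgebra ℚ (α → R))

theorem mul_entry_mem {M N : α → Matrix ι ι R} (hM : ∀ i j, (fun x => M x i j) ∈ S)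
    (hN : ∀ i j, (fun x => N x i j) ∈ S) (i j : ι) : (fun x => (M x * N x) i j) ∈ S := by
  have h : (fun x => (M x * N x) i j) =
      ∑ l, (fun x => M x i l) * (fun x => N x l j) := by
    ext x
    simp [Matrix.mul_apply]
  rw [h]
  exact sum_mem fun l _ => mul_mem (hM i l) (hN l j)

theorem pow_entry_mem [DecidableEq ι] {M : α → Matrix ι ι R}
    (hM : ∀ i j, (fun x => M x i j) ∈ S) (d : ℕ) (i j : ι) :
    (fun x => (M x ^ d) i j) ∈ S := by
  induction d generalizing i j with
  | zero =>
    simp only [pow_zero, Matrix.one_apply]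
    split_ifs
    · exact one_mem S
    · exact zero_mem S
  | succ d ih =>
    simp only [pow_succ]
    exact mul_entry_mem S ih hM i j

theorem trace_mem {M : α → Matrix ι ι R}
    (hM : ∀ i j, (fun x => M x i j) ∈ S) : (fun x => (M x).trace) ∈ S := by
  have h : (fun x => (M x).trace) = ∑ l, (fun x => M x l l) := by
    ext x
    simp [Matrix.trace]
  rw [h]
  exact sum_mem fun l _ => hM l l

end Entries

theorem pfaffian_mem {α : Type*} {m n : ℕ} (S : Subalgebra ℚ (α → Forms m))
    {M : α → Matrix (Fin (2 * n)) (Fin (2 * n)) (Forms m)}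
    (hM : ∀ i j, (fun x => M x i j) ∈ S) : (fun x => pfaffian n (M x)) ∈ S := by
  have h : (fun x => pfaffian n (M x)) = ((2 : ℚ) ^ n * (n.factorial : ℚ))⁻¹ •
      ∑ π : Equiv.Perm (Fin (2 * n)), (Equiv.Perm.sign π : ℤ) •
        (List.ofFn fun i : Fin n => fun x =>
          M x (π ⟨2 * (i : ℕ), by omega⟩) (π ⟨2 * (i : ℕ) + 1, by omega⟩)).prod := by
    ext x
    -- The normalising constant is rational, so a `ℚ`-subalgebra suffices.
    have hc : ((2 : ℝ) ^ n * (n.factorial : ℝ))⁻¹ =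
        ((((2 : ℚ) ^ n * (n.factorial : ℚ))⁻¹ : ℚ) : ℝ) := by push_cast; rfl
    rw [pfaffian, hc, Rat.cast_smul_eq_qsmul, Pi.smul_apply, Finset.sum_apply]
    congr 1
    refine Finset.sum_congr rfl fun π _ => ?_
    rw [Pi.smul_apply]
    congr 1
    have := map_list_prod (Pi.evalRingHom (fun _ : α => Forms m) x)
      (List.ofFn fun i : Fin n => fun x =>
          M x (π ⟨2 * (i : ℕ), by omega⟩) (π ⟨2 * (i : ℕ) + 1, by omega⟩))
    rw [List.map_ofFn] at this
    exact this.symm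
  rw [h]
  refine S.smul_mem (sum_mem fun π _ => zsmul_mem (list_prod_mem ?_) _) _
  intro f hf
  obtain ⟨i, rfl⟩ := (List.mem_ofFn' _ _).1 hf
  exact hM _ _

theorem realize_mem {α : Type*} {m : ℕ} (S : Subalgebra ℚ (α → Forms m)) (g : α → SPD m)
    (h : ∀ k, (fun x => beta m k (g x)) ∈ S) (ω : CanonicalForms) :
    (fun x => realize m ω (g x)) ∈ S := by
  induction ω using ExteriorAlgebra.induction with
  | algebraMap r =>
    rw [AlgHom.commutes]
    exact S.algebraMap_mem r
  | ι v =>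
    have hv : (fun x => realize m (ExteriorAlgebra.ι ℚ v) (g x)) =
        v.sum fun k c => c • fun x => beta m (k : ℕ) (g x) := by
      ext x
      rw [realize, ExteriorAlgebra.lift_ι_apply, betaLin, Finsupp.linearCombination_apply]
      simp only [Finsupp.sum, Finset.sum_apply, Pi.smul_apply]
    rw [hv]
    exact sum_mem fun k _ => S.smul_mem (h k) _
  | mul a b ha hb =>
    rw [map_mul]
    exact mul_mem ha hb
  | add a b ha hb =>
    rw [map_add]
    exact add_mem ha hb

theorem const_mul {m : ℕ} (A B : Matrix (Fin m) (Fin m) ℝ) :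
    const (A * B) = const A * const B := Matrix.map_mul

theorem const_one {m : ℕ} : const (1 : Matrix (Fin m) (Fin m) ℝ) = 1 :=
  Matrix.map_one _ (map_zero _) (map_one _)

/-- Cyclicity of the trace fails for general matrices of forms; it holds here because real scalars
are central. -/
theorem trace_const_mul {m : ℕ} (A : Matrix (Fin m) (Fin m) ℝ)
    (N : Matrix (Fin m) (Fin m) (Forms m)) : (const A * N).trace = (N * const A).trace := by
  simp only [Matrix.trace, Matrix.diag_apply, Matrix.mul_apply, const, Matrix.map_apply]
  rw [Finset.sum_comm]
  exact Finset.sum_congr rfl fun i _ => Finset.sum_congr rfl fun j _ => Algebra.commutes _ _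

theorem trace_conj_pow {m : ℕ} {A B : Matrix (Fin m) (Fin m) ℝ} (h : B * A = 1)
    (N : Matrix (Fin m) (Fin m) (Forms m)) (d : ℕ) :
    ((const A * N * const B) ^ d).trace = (N ^ d).trace := by
  have hBA : const B * const A = 1 := by rw [← const_mul, h, const_one]
  have hAB : const A * const B = 1 := by rw [← const_mul, mul_eq_one_comm.1 h, const_one]
  have hp : (const A * N * const B) ^ d = const A * N ^ d * const B :=
    (Units.mk (const A) (const B) hAB hBA).conj_pow N d
  rw [hp, mul_assoc, trace_const_mul, mul_assoc, hBA, mul_one]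

/-! ### Clearing denominators -/

/-- Evaluation of polynomials in matrix entries. -/
def evalMat {m : ℕ} (X : Matrix (Fin m) (Fin m) ℝ) : MvPolynomial (Fin m × Fin m) ℚ →ₐ[ℚ] ℝ :=
  MvPolynomial.aeval fun p => X p.1 p.2

/-- The matrix of coordinates. -/
def genMat (m : ℕ) : Matrix (Fin m) (Fin m) (MvPolynomial (Fin m × Fin m) ℚ) :=
  Matrix.of fun i j => MvPolynomial.X (i, j)

theorem genMat_map {m : ℕ} (X : Matrix (Fin m) (Fin m) ℝ) : (genMat m).map (evalMat X) = X := by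
  ext i j
  simp [genMat, evalMat]

theorem evalMat_det {m : ℕ} (X : Matrix (Fin m) (Fin m) ℝ) :
    evalMat X (genMat m).det = X.det := by
  rw [AlgHom.map_det, AlgHom.mapMatrix_apply, genMat_map]

theorem evalMat_adjugate {m : ℕ} (X : Matrix (Fin m) (Fin m) ℝ) (i j : Fin m) :
    evalMat X ((genMat m).adjugate i j) = X.adjugate i j := by
  have := AlgHom.map_adjugate (evalMat X) (genMat m)
  rw [AlgHom.mapMatrix_apply, AlgHom.mapMatrix_apply, genMat_map] at this
  rw [← this, Matrix.map_apply]

theorem evalMat_mem (m : ℕ) (p : MvPolynomial (Fin m × Fin m) ℚ) :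
    (fun X : SymMat m => algebraMap ℝ (Forms m) (evalMat X.1 p)) ∈ polynomialForms m := by
  induction p using MvPolynomial.induction_on with
  | C a =>
    convert (polynomialForms m).algebraMap_mem a using 1
    ext X
    simp only [evalMat, MvPolynomial.algHom_C, Pi.algebraMap_apply]
    exact (IsScalarTower.algebraMap_apply ℚ ℝ (Forms m) a).symm
  | add p q hp hq =>
    simp only [map_add]
    exact add_mem hp hq
  | mul_X p q hp =>
    simp only [map_mul]
    refine mul_mem hp (Algebra.subset_adjoin (Or.inl ⟨q, ?_⟩))
    simp [evalMat]

theorem dX_mem (m : ℕ) (i j : Fin m) : (fun _ : SymMat m => dX m i j) ∈ polynomialForms m :=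
  Algebra.subset_adjoin (Or.inr ⟨(i, j), rfl⟩)

theorem det_pow_smul_mem (m N : ℕ) {Q : SymMat m → Forms m} (hQ : Q ∈ polynomialForms m) :
    (fun X : SymMat m => (X.1.det ^ N) • Q X) ∈ polynomialForms m := by
  convert mul_mem (evalMat_mem m ((genMat m).det ^ N)) hQ using 1
  ext X
  rw [Pi.mul_apply, map_pow, evalMat_det, Algebra.smul_def]

/-- Forms on `SPD m` that are polynomial forms divided by a power of the determinant. -/
def clearable (m : ℕ) : Subalgebra ℚ (SPD m → Forms m) where
  carrier := {f | ∃ N : ℕ, ∃ Q ∈ polynomialForms m, ∀ X : SPD m, X.mat.det ^ N • f X = Q X.1}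
  mul_mem' := by
    rintro f g ⟨N, Q, hQ, hf⟩ ⟨N', Q', hQ', hg⟩
    refine ⟨N + N', Q * Q', mul_mem hQ hQ', fun X => ?_⟩
    rw [Pi.mul_apply, Pi.mul_apply, ← hf, ← hg, smul_mul_smul_comm, pow_add]
  add_mem' := by
    rintro f g ⟨N, Q, hQ, hf⟩ ⟨N', Q', hQ', hg⟩
    refine ⟨N + N', _, add_mem (det_pow_smul_mem m N' hQ) (det_pow_smul_mem m N hQ'),
      fun X => ?_⟩
    simp only [Pi.add_apply]
    rw [← hf, ← hg, smul_smul, smul_smul, smul_add, add_comm N, pow_add, ← SPD.mat,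
      mul_comm (X.mat.det ^ N')]
  algebraMap_mem' r := ⟨0, _, (polynomialForms m).algebraMap_mem r, fun X => by
    simp⟩

theorem const_inv_mem (m : ℕ) (i j : Fin m) :
    (fun X : SPD m => const X.mat⁻¹ i j) ∈ clearable m := by
  refine ⟨1, _, evalMat_mem m ((genMat m).adjugate i j), fun X => ?_⟩
  have hd : X.mat.det ≠ 0 := X.2.det_pos.ne'
  change _ • algebraMap ℝ (Forms m) (X.mat⁻¹ i j) = algebraMap ℝ (Forms m) (evalMat X.mat _)
  rw [evalMat_adjugate, Matrix.inv_def, Matrix.smul_apply, pow_one,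
    Ring.inverse_eq_inv', smul_eq_mul, map_mul, ← Algebra.smul_def, smul_smul,
    mul_inv_cancel₀ hd, one_smul]

theorem dX_mem_clearable (m : ℕ) (i j : Fin m) : (fun _ : SPD m => dX m i j) ∈ clearable m :=
  ⟨0, _, dX_mem m i j, fun X => by simp⟩

theorem exists_clear (n : ℕ) (ω : CanonicalForms) :
    ∃ N : ℕ, ∃ Q ∈ polynomialForms (2 * n), ∀ X : SPD (2 * n),
      X.mat.det ^ N • (realize (2 * n) ω X *
        pfaffian n (dX (2 * n) * const X.mat⁻¹ * dX (2 * n))) = Q X.1 := by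
  have h1 : ∀ k, (fun X => beta (2 * n) k X) ∈ clearable (2 * n) := fun k =>
    trace_mem _ (pow_entry_mem _ (mul_entry_mem _ (const_inv_mem _) (dX_mem_clearable _)) _)
  have h2 := realize_mem _ id h1 ω
  have h3 := pfaffian_mem (n := n) (clearable (2 * n)) (mul_entry_mem _
    (mul_entry_mem _ (dX_mem_clearable _) (const_inv_mem _)) (dX_mem_clearable _))
  exact mul_mem h2 h3

/-! ### Forms in an orthogonal frame -/

theorem list_prod_map_smul {ι R : Type*} [Ring R] [Algebra ℝ R] (c : ι → ℝ) (e : ι → R)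
    (L : List ι) : (L.map fun q => c q • e q).prod = (L.map c).prod • (L.map e).prod := by
  induction L with
  | nil => simp
  | cons a L ih => simp only [List.map_cons, List.prod_cons, ih, smul_mul_smul_comm]

theorem list_prod_ι_eq_zero {ι V : Type*} [AddCommGroup V] [Module ℝ V] (η : ι → V)
    {L : List ι} (hL : ¬ L.Nodup) : (L.map fun q => ExteriorAlgebra.ι ℝ (η q)).prod = 0 := by
  have h : (L.map fun q => ExteriorAlgebra.ι ℝ (η q)) =
      List.ofFn fun i : Fin L.length => ExteriorAlgebra.ι ℝ (η (L.get i)) := by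
    rw [← List.ofFn_get (l := L.map _)]
    apply List.ext_get <;> simp
  rw [h, ← ExteriorAlgebra.ιMulti_apply]
  refine AlternatingMap.map_eq_zero_of_not_injective _ _ fun hinj => hL ?_
  exact List.nodup_iff_injective_get.2 fun i j hij => hinj (congrArg η hij)

/-- Indices of the independent entries of a symmetric matrix. -/
abbrev UpperPair (m : ℕ) : Type := {p : Fin m × Fin m // p.1 ≤ p.2}

/-- Each index meets all `m` indices, and the diagonal pair counts it twice. This is the source of
the exponent `2n + 1`. -/
theorem prod_upperPair {m : ℕ} (x : Fin m → ℝ) :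
    ∏ q : UpperPair m, x q.1.1 * x q.1.2 = (∏ i, x i) ^ (m + 1) := by
  have h1 : ∀ f : Fin m × Fin m → ℝ, ∏ q : UpperPair m, f q.1 =
      ∏ i, ∏ j, if i ≤ j then f (i, j) else 1 := by
    intro f
    rw [← Fintype.prod_prod_type' (f := fun i j => if i ≤ j then f (i, j) else 1),
      ← Finset.prod_filter, ← Finset.prod_subtype_eq_prod_filter]
    refine Finset.prod_bij (fun q _ => ⟨q.1, q.2⟩) ?_ ?_ ?_ ?_ <;> simp
  rw [Finset.prod_mul_distrib, h1 fun p => x p.1, h1 fun p => x p.2]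
  rw [Finset.prod_comm (f := fun i j => if i ≤ j then x (i, j).2 else 1), ← Finset.prod_mul_distrib]
  simp only [← Finset.prod_mul_distrib]
  have h2 : ∀ i j : Fin m, ((if i ≤ j then x i else 1) * if j ≤ i then x i else 1) =
      x i * if i = j then x i else 1 := by
    intro i j
    rcases lt_trichotomy i j with h | h | h
    · simp [h.le, h.not_ge, h.ne]
    · simp [h]
    · simp [h.le, h.not_ge, h.ne']
  simp only [h2, Finset.prod_mul_distrib, Finset.prod_ite_eq, Finset.mem_univ, if_true,
    Finset.prod_const, Finset.card_univ, Fintype.card_fin, Finset.prod_pow]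
  rw [pow_succ]

/-- The linear functional `Y ↦ (Uᵀ Y U) i j`. -/
def frameCoord {m : ℕ} (U : Matrix (Fin m) (Fin m) ℝ) (i j : Fin m) : Module.Dual ℝ (SymMat m) :=
  ∑ b, ∑ a, (U a i * U b j) • coord m a b

/-- The matrix of one-forms `Uᵀ dX U`. -/
def frameForm {m : ℕ} (U : Matrix (Fin m) (Fin m) ℝ) : Matrix (Fin m) (Fin m) (Forms m) :=
  Matrix.of fun i j => ExteriorAlgebra.ι ℝ (frameCoord U i j)

theorem frameForm_eq {m : ℕ} (U : Matrix (Fin m) (Fin m) ℝ) :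
    frameForm U = const U.transpose * dX m * const U := by
  ext i j
  simp only [frameForm, frameCoord, Matrix.of_apply, map_sum, map_smul, Matrix.mul_apply, const,
    Matrix.map_apply, Matrix.transpose_apply, dX, Finset.sum_mul]
  refine Finset.sum_congr rfl fun b _ => Finset.sum_congr rfl fun a _ => ?_
  rw [← Algebra.smul_def, ← Algebra.commutes, ← Algebra.smul_def, smul_smul, mul_comm]

theorem frameForm_symm {m : ℕ} (U : Matrix (Fin m) (Fin m) ℝ) (i j : Fin m) :
    frameForm U i j = frameForm U j i := by
  have h : frameCoord U i j = frameCoord U j i := by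
    rw [frameCoord, frameCoord, Finset.sum_comm]
    refine Finset.sum_congr rfl fun a _ => Finset.sum_congr rfl fun b _ => ?_
    have : coord m a b = coord m b a := by
      ext X
      exact congrFun (congrFun X.2 b) a
    rw [this, mul_comm]
  simp [frameForm, h]

/-- Vectors with positive entries. -/
abbrev PosVec (m : ℕ) : Type := {σ : Fin m → ℝ // ∀ i, 0 < σ i}

/-- The algebra of functions of `σ` generated by the `σ i` and the one-forms
`(σ i σ j)⁻¹ (Uᵀ dX U) i j`. -/
def scaledForms {m : ℕ} (U : Matrix (Fin m) (Fin m) ℝ) : Subalgebra ℝ (PosVec m → Forms m) :=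
  Algebra.adjoin ℝ
    ((Set.range fun i => fun σ : PosVec m => algebraMap ℝ (Forms m) (σ.1 i)) ∪
      Set.range fun q : UpperPair m => fun σ : PosVec m =>
        (σ.1 q.1.1 * σ.1 q.1.2)⁻¹ • frameForm U q.1.1 q.1.2)

theorem scaledForms_le_span {m : ℕ} (U : Matrix (Fin m) (Fin m) ℝ) {f : PosVec m → Forms m}
    (hf : f ∈ scaledForms U) :
    f ∈ Submodule.span ℝ (Set.range fun pL : MvPolynomial (Fin m) ℝ × List (UpperPair m) =>
      fun σ : PosVec m => MvPolynomial.eval σ.1 pL.1 • (pL.2.map fun q =>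
        (σ.1 q.1.1 * σ.1 q.1.2)⁻¹ • frameForm U q.1.1 q.1.2).prod) := by
  induction hf using Algebra.adjoin_induction with
  | mem f hf =>
    rcases hf with ⟨i, rfl⟩ | ⟨q, rfl⟩
    · exact Submodule.subset_span ⟨(MvPolynomial.X i, []), by
        ext σ; simp [Algebra.algebraMap_eq_smul_one]⟩
    · exact Submodule.subset_span ⟨(1, [q]), by ext σ; simp⟩
  | algebraMap r =>
    exact Submodule.subset_span ⟨(MvPolynomial.C r, []), by
      ext σ; simp [Algebra.algebraMap_eq_smul_one]⟩
  | add f g _ _ hf hg => exact add_mem hf hg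
  | mul f g _ _ hf hg =>
    have h := Submodule.mul_mem_mul hf hg
    rw [Submodule.span_mul_span] at h
    refine Submodule.span_mono ?_ h
    rintro _ ⟨_, ⟨⟨p, L⟩, rfl⟩, _, ⟨⟨p', L'⟩, rfl⟩, rfl⟩
    refine ⟨(p * p', L ++ L'), ?_⟩
    ext σ
    simp only [map_mul, List.map_append, List.prod_append, Pi.mul_apply, smul_mul_smul_comm]

/-- A word in the scaled one-forms vanishes if a letter repeats, so its denominator divides the
product of `σ i σ j` over all pairs `i ≤ j`. -/
theorem scaledForms_bound {m : ℕ} (U : Matrix (Fin m) (Fin m) ℝ) {f : PosVec m → Forms m}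
    (hf : f ∈ scaledForms U) (l : Forms m →ₗ[ℝ] ℝ) :
    ∃ G : MvPolynomial (Fin m) ℝ, ∀ σ : PosVec m,
      (∏ i, σ.1 i) ^ (m + 1) * l (f σ) = MvPolynomial.eval σ.1 G := by
  have h := scaledForms_le_span U hf
  clear hf
  induction h using Submodule.span_induction with
  | zero => exact ⟨0, fun σ => by simp⟩
  | add f g _ _ hf hg =>
    obtain ⟨G, hG⟩ := hf
    obtain ⟨G', hG'⟩ := hg
    exact ⟨G + G', fun σ => by rw [Pi.add_apply, map_add, mul_add, hG, hG', map_add]⟩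
  | smul r f _ hf =>
    obtain ⟨G, hG⟩ := hf
    exact ⟨MvPolynomial.C r * G, fun σ => by
      rw [Pi.smul_apply, map_smul, smul_eq_mul, mul_left_comm, hG, map_mul, MvPolynomial.eval_C]⟩
  | mem f hf =>
    obtain ⟨⟨p, L⟩, rfl⟩ := hf
    simp only [list_prod_map_smul]
    by_cases hL : L.Nodup
    -- The pairs absent from the word survive as a numerator.
    · refine ⟨p * ((∏ q ∈ L.toFinsetᶜ, MvPolynomial.X q.1.1 * MvPolynomial.X q.1.2) *
        MvPolynomial.C (l (L.map fun q => frameForm U q.1.1 q.1.2).prod)), fun σ => ?_⟩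
      have h0 : ∏ q ∈ L.toFinset, σ.1 q.1.1 * σ.1 q.1.2 ≠ 0 :=
        Finset.prod_ne_zero_iff.2 fun q _ => (mul_pos (σ.2 _) (σ.2 _)).ne'
      have h1 : (L.map fun q => (σ.1 q.1.1 * σ.1 q.1.2)⁻¹).prod =
          (∏ q ∈ L.toFinset, σ.1 q.1.1 * σ.1 q.1.2)⁻¹ := by
        rw [← List.prod_toFinset _ hL, Finset.prod_inv_distrib]
      rw [← prod_upperPair, ← Finset.prod_mul_prod_compl L.toFinset, h1]
      simp only [map_smul, smul_eq_mul, map_mul, map_prod, MvPolynomial.eval_X,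
        MvPolynomial.eval_C]
      field_simp
    · refine ⟨0, fun σ => ?_⟩
      have : (L.map fun q : UpperPair m => frameForm U q.1.1 q.1.2).prod = 0 :=
        list_prod_ι_eq_zero (fun q : UpperPair m => frameCoord U q.1.1 q.1.2) hL
      rw [this]
      simp

/-- The matrix of one-forms `(σ i σ j)⁻¹ (Uᵀ dX U) i j`. -/
def scaledMat {m : ℕ} (U : Matrix (Fin m) (Fin m) ℝ) (σ : PosVec m) :
    Matrix (Fin m) (Fin m) (Forms m) :=
  const (Matrix.diagonal fun i => (σ.1 i)⁻¹) * frameForm U *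
    const (Matrix.diagonal fun i => (σ.1 i)⁻¹)

theorem scaledMat_mem {m : ℕ} (U : Matrix (Fin m) (Fin m) ℝ) (i j : Fin m) :
    (fun σ => scaledMat U σ i j) ∈ scaledForms U := by
  have h : ∀ σ, scaledMat U σ i j = (σ.1 i * σ.1 j)⁻¹ • frameForm U i j := by
    intro σ
    rw [scaledMat, const, Matrix.diagonal_map (map_zero _), Matrix.mul_diagonal,
      Matrix.diagonal_mul, ← Algebra.smul_def, ← Algebra.commutes, ← Algebra.smul_def, smul_smul,
      mul_inv, mul_comm]
  simp only [h]
  rcases le_total i j with hij | hij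
  · exact Algebra.subset_adjoin (Or.inr ⟨⟨(i, j), hij⟩, rfl⟩)
  · refine Algebra.subset_adjoin (Or.inr ⟨⟨(j, i), hij⟩, ?_⟩)
    ext σ
    rw [frameForm_symm U i j, mul_comm (σ.1 i)]

/-- The symmetric matrix `U diag(x) Uᵀ`. -/
def symDiag {m : ℕ} (U : Matrix (Fin m) (Fin m) ℝ) (x : Fin m → ℝ) : SymMat m :=
  ⟨U * Matrix.diagonal x * U.transpose, by
    change Matrix.transpose _ = _
    simp [Matrix.transpose_mul, mul_assoc]⟩

theorem det_symDiag {m : ℕ} {U : Matrix (Fin m) (Fin m) ℝ} (hU : U.transpose * U = 1)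
    (x : Fin m → ℝ) : (symDiag U x).1.det = ∏ i, x i := by
  have h : U.transpose.det * U.det = 1 := by rw [← Matrix.det_mul, hU, Matrix.det_one]
  change (U * Matrix.diagonal x * U.transpose).det = _
  rw [Matrix.det_mul, Matrix.det_mul, Matrix.det_diagonal, mul_right_comm, mul_comm U.det, h,
    one_mul]

/-- The positive definite matrix `U diag(σ²) Uᵀ`. -/
def diagPoint {m : ℕ} {U : Matrix (Fin m) (Fin m) ℝ} (hU : U.transpose * U = 1)
    (σ : PosVec m) : SPD m :=
  ⟨symDiag U fun i => σ.1 i ^ 2, by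
    have h : (Matrix.diagonal fun i => σ.1 i ^ 2).PosDef :=
      Matrix.PosDef.diagonal fun i => pow_pos (σ.2 i) 2
    refine h.mul_mul_conjTranspose_same ?_
    exact Matrix.vecMul_injective_of_isUnit
      (IsUnit.of_mul_eq_one U.transpose (mul_eq_one_comm.1 hU))⟩

theorem inv_diagPoint {m : ℕ} {U : Matrix (Fin m) (Fin m) ℝ} (hU : U.transpose * U = 1)
    (σ : PosVec m) : (diagPoint hU σ).mat⁻¹ =
      U * Matrix.diagonal (fun i => (σ.1 i)⁻¹) *
        (Matrix.diagonal (fun i => (σ.1 i)⁻¹) * U.transpose) := by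
  have hd : (Matrix.diagonal fun i => σ.1 i ^ 2) * (Matrix.diagonal (fun i => (σ.1 i)⁻¹) *
      Matrix.diagonal (fun i => (σ.1 i)⁻¹)) = 1 := by
    rw [Matrix.diagonal_mul_diagonal, Matrix.diagonal_mul_diagonal, ← Matrix.diagonal_one]
    congr 1
    ext i
    have := (σ.2 i).ne'
    field_simp
  refine Matrix.inv_eq_right_inv ?_
  change U * Matrix.diagonal (fun i => σ.1 i ^ 2) * U.transpose * _ = 1
  calc _ = U * (Matrix.diagonal (fun i => σ.1 i ^ 2) * ((U.transpose * U) *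
        (Matrix.diagonal (fun i => (σ.1 i)⁻¹) * Matrix.diagonal (fun i => (σ.1 i)⁻¹)))) *
        U.transpose := by simp only [mul_assoc]
    _ = 1 := by rw [hU, one_mul, hd, mul_one, mul_eq_one_comm.1 hU]

theorem const_diagonal_inv_mul {m : ℕ} (σ : PosVec m) :
    const (Matrix.diagonal fun i => (σ.1 i)⁻¹) * const (Matrix.diagonal σ.1) = 1 := by
  rw [← const_mul, Matrix.diagonal_mul_diagonal, ← const_one, ← Matrix.diagonal_one]
  congr 2
  ext i
  exact inv_mul_cancel₀ (σ.2 i).ne'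

theorem diagonal_mul_inv {m : ℕ} (σ : PosVec m) :
    Matrix.diagonal σ.1 * (Matrix.diagonal fun i => (σ.1 i)⁻¹) = 1 := by
  rw [Matrix.diagonal_mul_diagonal, ← Matrix.diagonal_one]
  congr 1
  ext i
  exact mul_inv_cancel₀ (σ.2 i).ne'

theorem beta_diagPoint {m : ℕ} {U : Matrix (Fin m) (Fin m) ℝ} (hU : U.transpose * U = 1)
    (σ : PosVec m) (k : ℕ) : beta m k (diagPoint hU σ) = (scaledMat U σ ^ (4 * k + 1)).trace := by
  have h : (Matrix.diagonal σ.1 * U.transpose) *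
      (U * Matrix.diagonal (fun i => (σ.1 i)⁻¹)) = 1 := by
    rw [mul_assoc, ← mul_assoc U.transpose, hU, one_mul, diagonal_mul_inv]
  rw [← trace_conj_pow h, beta, inv_diagPoint, scaledMat, frameForm_eq]
  congr 2
  have e1 := const_diagonal_inv_mul σ
  have e2 : const U * const U.transpose = 1 := by
    rw [← const_mul, mul_eq_one_comm.1 hU, const_one]
  simp only [const_mul, mul_assoc]
  rw [← mul_assoc (const (Matrix.diagonal fun i => (σ.1 i)⁻¹)) (const (Matrix.diagonal σ.1)), e1,
    one_mul, e2, mul_one]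

/-- The outer factors involve only positive powers of `σ`, so no denominators arise beyond those in
`scaledMat`. -/
theorem dX_inv_dX_diagPoint {m : ℕ} {U : Matrix (Fin m) (Fin m) ℝ} (hU : U.transpose * U = 1)
    (σ : PosVec m) : dX m * const (diagPoint hU σ).mat⁻¹ * dX m =
      const (U * Matrix.diagonal σ.1) * (scaledMat U σ * scaledMat U σ) *
        const (Matrix.diagonal σ.1 * U.transpose) := by
  have e1 := const_diagonal_inv_mul σ
  have e2 : const U * const U.transpose = 1 := by
    rw [← const_mul, mul_eq_one_comm.1 hU, const_one]
  have h1 : const (Matrix.diagonal σ.1) * (const (Matrix.diagonal fun i => (σ.1 i)⁻¹)) = 1 := by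
    rw [← const_mul, diagonal_mul_inv, const_one]
  have c1 : ∀ N, const (Matrix.diagonal σ.1) *
      (const (Matrix.diagonal fun i => (σ.1 i)⁻¹) * N) = N := fun N => by
    rw [← mul_assoc, h1, one_mul]
  have c2 : ∀ N, const U * (const U.transpose * N) = N := fun N => by
    rw [← mul_assoc, e2, one_mul]
  have c3 : ∀ N, const (Matrix.diagonal fun i => (σ.1 i)⁻¹) *
      (const (Matrix.diagonal σ.1) * N) = N := fun N => by rw [← mul_assoc, e1, one_mul]
  rw [inv_diagPoint, scaledMat, frameForm_eq]
  simp only [const_mul, mul_assoc, c1, c2, c3, e2, mul_one]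

theorem realize_mul_pfaffian_mem {n : ℕ} {U : Matrix (Fin (2 * n)) (Fin (2 * n)) ℝ}
    (hU : U.transpose * U = 1) (ω : CanonicalForms) :
    (fun σ => realize (2 * n) ω (diagPoint hU σ) * pfaffian n
      (dX (2 * n) * const (diagPoint hU σ).mat⁻¹ * dX (2 * n))) ∈ scaledForms U := by
  have hs : ∀ i j, (fun σ => scaledMat U σ i j) ∈ (scaledForms U).restrictScalars ℚ :=
    scaledMat_mem U
  have h1 := realize_mem ((scaledForms U).restrictScalars ℚ) (diagPoint hU) (fun k => by
    simp only [beta_diagPoint]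
    exact trace_mem _ (pow_entry_mem _ hs _)) ω
  have hr : ∀ r : ℝ, (fun _ : PosVec (2 * n) => algebraMap ℝ (Forms (2 * n)) r) ∈
      scaledForms U := fun r => (scaledForms U).algebraMap_mem r
  have hσ : ∀ i, (fun σ : PosVec (2 * n) => algebraMap ℝ (Forms (2 * n)) (σ.1 i)) ∈
      scaledForms U := fun i => Algebra.subset_adjoin (Or.inl ⟨i, rfl⟩)
  have hA : ∀ i j, (fun σ : PosVec (2 * n) => const (U * Matrix.diagonal σ.1) i j) ∈
      (scaledForms U).restrictScalars ℚ := by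
    intro i j
    simp only [const, Matrix.map_apply, Matrix.mul_diagonal, map_mul]
    exact mul_mem (hr _) (hσ j)
  have hB : ∀ i j, (fun σ : PosVec (2 * n) => const (Matrix.diagonal σ.1 * U.transpose) i j) ∈
      (scaledForms U).restrictScalars ℚ := by
    intro i j
    simp only [const, Matrix.map_apply, Matrix.diagonal_mul, map_mul]
    exact mul_mem (hσ i) (hr _)
  have h2 : (fun σ => pfaffian n (dX (2 * n) * const (diagPoint hU σ).mat⁻¹ * dX (2 * n))) ∈
      (scaledForms U).restrictScalars ℚ := by
    simp only [dX_inv_dX_diagPoint]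
    exact pfaffian_mem _ (mul_entry_mem _ (mul_entry_mem _ hA (mul_entry_mem _ hs hs)) hB)
  exact mul_mem h1 h2

/-! ### Division by powers of the determinant -/

/-- An exponent `d i` occurring in `P` satisfies `2N ≤ 2n + 1 + 2 d i`; by parity `d i ≥ N - n`,
which gains the half power. -/
theorem prod_X_pow_dvd {m n N : ℕ} {P G : MvPolynomial (Fin m) ℝ}
    (h : ∀ σ : PosVec m, (∏ i, σ.1 i) ^ (2 * n + 1) *
      MvPolynomial.eval (fun i => σ.1 i ^ 2) P = (∏ i, σ.1 i) ^ (2 * N) * MvPolynomial.eval σ.1 G) :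
    (∏ i, MvPolynomial.X i) ^ (N - n) ∣ P := by
  have hmon : ∀ k : ℕ, (∏ i : Fin m, (MvPolynomial.X i : MvPolynomial (Fin m) ℝ)) ^ k =
      MvPolynomial.monomial (Finsupp.equivFunOnFinite.symm fun _ => k) 1 := by
    intro k
    rw [MvPolynomial.monomial_eq, Finsupp.prod_fintype _ _ fun i => pow_zero _,
      ← Finset.prod_pow]
    simp
  have key : (∏ i : Fin m, (MvPolynomial.X i : MvPolynomial (Fin m) ℝ)) ^ (2 * n + 1) *
      MvPolynomial.expand 2 P = (∏ i, MvPolynomial.X i) ^ (2 * N) * G := by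
    refine MvPolynomial.funext_set (fun _ => Set.Ioi 0) (fun _ => Set.Ioi_infinite 0)
      fun x hx => ?_
    have := h ⟨x, fun i => hx i (Set.mem_univ i)⟩
    simpa [MvPolynomial.eval_expand, map_prod, Pi.pow_def] using this
  rw [hmon, hmon] at key
  rw [hmon, P.as_sum]
  refine Finset.dvd_sum fun d hd => ?_
  refine MvPolynomial.monomial_dvd_monomial.2 ⟨Or.inr fun i => ?_, one_dvd _⟩
  -- On the left this coefficient is that of `d` in `P`; on the right it is zero unless `2N` is at
  -- most every exponent.
  have hc := congrArg (MvPolynomial.coeff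
    ((Finsupp.equivFunOnFinite.symm fun _ => 2 * n + 1) + 2 • d)) key
  rw [MvPolynomial.coeff_monomial_mul, one_mul,
    MvPolynomial.coeff_expand_smul _ two_ne_zero, MvPolynomial.coeff_monomial_mul'] at hc
  split_ifs at hc with hle
  · have := hle i
    simp at this ⊢
    omega
  · exact absurd hc (MvPolynomial.mem_support_iff.1 hd)

/-- The constant polynomial forms. -/
def constForms (m : ℕ) : Subalgebra ℚ (Forms m) :=
  Algebra.adjoin ℚ (Set.range fun p : Fin m × Fin m => dX m p.1 p.2)

theorem constForms_mem {m : ℕ} {μ : Forms m} (hμ : μ ∈ constForms m) :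
    (fun _ : SymMat m => μ) ∈ polynomialForms m := by
  induction hμ using Algebra.adjoin_induction with
  | mem x hx =>
    obtain ⟨p, rfl⟩ := hx
    exact dX_mem m p.1 p.2
  | algebraMap r => exact (polynomialForms m).algebraMap_mem r
  | add x y _ _ hx hy => exact add_mem hx hy
  | mul x y _ _ hx hy => exact mul_mem hx hy

theorem polynomialForms_le_span {m : ℕ} {Q : SymMat m → Forms m} (hQ : Q ∈ polynomialForms m) :
    Q ∈ Submodule.span ℚ (Set.range fun pμ : MvPolynomial (Fin m × Fin m) ℚ × constForms m =>
      fun X : SymMat m => evalMat X.1 pμ.1 • (pμ.2 : Forms m)) := by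
  induction hQ using Algebra.adjoin_induction with
  | mem f hf =>
    rcases hf with ⟨p, rfl⟩ | ⟨p, rfl⟩
    · exact Submodule.subset_span ⟨(MvPolynomial.X p, 1), by
        ext X; simp [evalMat, Algebra.algebraMap_eq_smul_one]⟩
    · exact Submodule.subset_span ⟨(1, ⟨_, Algebra.subset_adjoin ⟨p, rfl⟩⟩), by
        ext X; simp⟩
  | algebraMap r =>
    refine Submodule.subset_span ⟨(1, algebraMap ℚ _ r), ?_⟩
    ext X
    simp only [map_one, one_smul]
    rfl
  | add f g _ _ hf hg => exact add_mem hf hg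
  | mul f g _ _ hf hg =>
    have h := Submodule.mul_mem_mul hf hg
    rw [Submodule.span_mul_span] at h
    refine Submodule.span_mono ?_ h
    rintro _ ⟨_, ⟨⟨p, μ⟩, rfl⟩, _, ⟨⟨p', μ'⟩, rfl⟩, rfl⟩
    refine ⟨(p * p', μ * μ'), ?_⟩
    ext X
    simp only [map_mul, Subalgebra.coe_mul, Pi.mul_apply, smul_mul_smul_comm]

theorem exists_eval_symDiag {m : ℕ} {Q : SymMat m → Forms m} (hQ : Q ∈ polynomialForms m)
    (U : Matrix (Fin m) (Fin m) ℝ) (l : Forms m →ₗ[ℝ] ℝ) :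
    ∃ P : MvPolynomial (Fin m) ℝ, ∀ x, MvPolynomial.eval x P = l (Q (symDiag U x)) := by
  have h := polynomialForms_le_span hQ
  clear hQ
  induction h using Submodule.span_induction with
  | zero => exact ⟨0, fun x => by simp⟩
  | add f g _ _ hf hg =>
    obtain ⟨P, hP⟩ := hf
    obtain ⟨P', hP'⟩ := hg
    exact ⟨P + P', fun x => by rw [Pi.add_apply, map_add, map_add, hP, hP']⟩
  | smul r f _ hf =>
    obtain ⟨P, hP⟩ := hf
    refine ⟨MvPolynomial.C (r : ℝ) * P, fun x => ?_⟩
    rw [Pi.smul_apply, ← Rat.cast_smul_eq_qsmul ℝ, map_smul, smul_eq_mul, map_mul, hP,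
      MvPolynomial.eval_C]
  | mem f hf =>
    obtain ⟨⟨p, μ⟩, rfl⟩ := hf
    refine ⟨MvPolynomial.aeval (fun q : Fin m × Fin m =>
      ∑ k, MvPolynomial.C (U q.1 k * U q.2 k) * MvPolynomial.X k) p * MvPolynomial.C (l μ),
      fun x => ?_⟩
    simp only [map_smul, smul_eq_mul, map_mul, MvPolynomial.eval_C]
    congr 1
    change ((MvPolynomial.eval x).toRatAlgHom.comp (MvPolynomial.aeval _)) p = _
    rw [evalMat]
    congr 1
    ext q
    have hq : (symDiag U x).1 q.1 q.2 = ∑ k, U q.1 k * x k * U q.2 k := by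
      change (U * Matrix.diagonal x * U.transpose) q.1 q.2 = _
      simp only [Matrix.mul_apply (M := U * Matrix.diagonal x), Matrix.mul_diagonal,
        Matrix.transpose_apply]
    rw [AlgHom.comp_apply, MvPolynomial.aeval_X, MvPolynomial.aeval_X]
    refine Eq.trans ?_ hq.symm
    simp only [RingHom.toRatAlgHom_apply, map_sum, map_mul, MvPolynomial.eval_X,
      MvPolynomial.eval_C]
    exact Finset.sum_congr rfl fun k _ => by ring

/-! ### Descent from slices by monic division -/

/-- The identity matrix as a symmetric matrix. -/
def oneSym (m : ℕ) : SymMat m := ⟨1, Matrix.transpose_one⟩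

theorem eval_charpoly_neg {m : ℕ} (X : SymMat m) (τ : ℝ) :
    (-X.1).charpoly.eval τ = (X + τ • oneSym m).1.det := by
  rw [Matrix.eval_charpoly, sub_neg_eq_add, add_comm]
  congr 1
  change _ = X.1 + τ • (1 : Matrix (Fin m) (Fin m) ℝ)
  rw [Matrix.scalar_apply, Matrix.smul_one_eq_diagonal]

/-- The substitution `X ↦ X + t` in polynomials in the matrix entries. -/
def shift (m : ℕ) : MvPolynomial (Fin m × Fin m) ℚ →ₐ[ℚ]
    Polynomial (MvPolynomial (Fin m × Fin m) ℚ) :=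
  MvPolynomial.aeval fun p => Polynomial.C (MvPolynomial.X p) + if p.1 = p.2 then Polynomial.X else 0

theorem eval_shift {m : ℕ} (X : SymMat m) (τ : ℝ) (p : MvPolynomial (Fin m × Fin m) ℚ) :
    ((shift m p).map (evalMat X.1).toRingHom).eval τ = evalMat (X + τ • oneSym m).1 p := by
  change (((Polynomial.evalRingHom τ).comp
    (Polynomial.mapRingHom (evalMat X.1).toRingHom)).toRatAlgHom.comp (shift m)) p = _
  refine DFunLike.congr_fun ?_ p
  ext q
  have h1 : (X + τ • oneSym m).1 q.1 q.2 =
      X.1 q.1 q.2 + τ * (1 : Matrix (Fin m) (Fin m) ℝ) q.1 q.2 := rfl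
  have h2 : evalMat (X + τ • oneSym m).1 (MvPolynomial.X q) = (X + τ • oneSym m).1 q.1 q.2 :=
    MvPolynomial.aeval_X _ _
  rw [AlgHom.comp_apply, shift, MvPolynomial.aeval_X, h2, h1]
  by_cases h : q.1 = q.2 <;> simp [h, evalMat, Matrix.one_apply]

/-- The division is done once over `ℚ[X i j]`, by a power of the generic characteristic polynomial.
Being monic division, it commutes with evaluation at every `X`, singular or not; hence `Q'` depends
on neither `X` nor `l`. -/
theorem exists_div_mod {m : ℕ} (K : ℕ) {Q : SymMat m → Forms m} (hQ : Q ∈ polynomialForms m) :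
    ∃ Q' ∈ polynomialForms m, ∀ (X : SymMat m) (l : Forms m →ₗ[ℝ] ℝ), ∃ h r : Polynomial ℝ,
      r.degree < ((-X.1).charpoly ^ K).degree ∧
      (∀ τ, l (Q (X + τ • oneSym m)) = ((-X.1).charpoly ^ K * h + r).eval τ) ∧
      h.eval 0 = l (Q' X) := by
  have h := polynomialForms_le_span hQ
  clear hQ
  have hbot : ∀ X : SymMat m, ⊥ < ((-X.1).charpoly ^ K).degree := fun X =>
    bot_lt_iff_ne_bot.2 (Polynomial.degree_ne_bot.2 ((-X.1).charpoly_monic.pow K).ne_zero)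
  induction h using Submodule.span_induction with
  | zero => exact ⟨0, zero_mem _, fun X l => ⟨0, 0, by simpa using hbot X, by simp, by simp⟩⟩
  | add f g _ _ hf hg =>
    obtain ⟨f', hf', hf⟩ := hf
    obtain ⟨g', hg', hg⟩ := hg
    refine ⟨f' + g', add_mem hf' hg', fun X l => ?_⟩
    obtain ⟨h, r, h1, h2, h3⟩ := hf X l
    obtain ⟨k, s, k1, k2, k3⟩ := hg X l
    refine ⟨h + k, r + s, (Polynomial.degree_add_le _ _).trans_lt (max_lt h1 k1), fun τ => ?_, ?_⟩
    · rw [Pi.add_apply, map_add, h2, k2, ← Polynomial.eval_add]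
      congr 1
      ring
    · rw [Pi.add_apply, map_add, Polynomial.eval_add, h3, k3]
  | smul c f _ hf =>
    obtain ⟨f', hf', hf⟩ := hf
    refine ⟨c • f', Subalgebra.smul_mem _ hf' _, fun X l => ?_⟩
    obtain ⟨h, r, h1, h2, h3⟩ := hf X l
    refine ⟨(c : ℝ) • h, (c : ℝ) • r, (Polynomial.degree_smul_le _ _).trans_lt h1,
      fun τ => ?_, ?_⟩
    · rw [Pi.smul_apply, ← Rat.cast_smul_eq_qsmul ℝ, map_smul, h2, mul_smul_comm, ← smul_add,
        Polynomial.eval_smul]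
    · rw [Pi.smul_apply, ← Rat.cast_smul_eq_qsmul ℝ, map_smul, Polynomial.eval_smul, h3]
  | mem f hf =>
    obtain ⟨⟨p, μ⟩, rfl⟩ := hf
    have hχ := (-genMat m).charpoly_monic.pow K
    have hmap : ∀ X : SymMat m,
        ((-genMat m).charpoly ^ K).map (evalMat X.1).toRingHom = (-X.1).charpoly ^ K := by
      intro X
      rw [Polynomial.map_pow, ← Matrix.charpoly_map]
      congr 2
      conv_rhs => rw [← genMat_map X.1]
      ext i j
      simp
    refine ⟨_, mul_mem (evalMat_mem m
      ((shift m p /ₘ ((-genMat m).charpoly ^ K)).eval 0)) (constForms_mem μ.2),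
      fun X l => ⟨l μ • (shift m p /ₘ ((-genMat m).charpoly ^ K)).map (evalMat X.1).toRingHom,
        l μ • (shift m p %ₘ ((-genMat m).charpoly ^ K)).map (evalMat X.1).toRingHom, ?_, ?_, ?_⟩⟩
    · refine (Polynomial.degree_smul_le _ _).trans_lt ?_
      rw [← hmap, Polynomial.map_modByMonic _ hχ]
      exact Polynomial.degree_modByMonic_lt _ (hχ.map _)
    · intro τ
      rw [mul_smul_comm, ← smul_add, ← hmap, ← Polynomial.map_mul, ← Polynomial.map_add,
        add_comm (_ * _), Polynomial.modByMonic_add_div, Polynomial.eval_smul, eval_shift]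
      simp [mul_comm]
    · rw [Pi.mul_apply, ← Algebra.smul_def, map_smul, Polynomial.eval_smul, smul_eq_mul,
        smul_eq_mul, mul_comm]
      congr 1
      have := Polynomial.eval_map_apply (f := (evalMat X.1).toRingHom)
        (p := shift m p /ₘ ((-genMat m).charpoly ^ K)) (0 : MvPolynomial (Fin m × Fin m) ℚ)
      rw [map_zero] at this
      exact this

theorem exists_symDiag_eq {m : ℕ} (X : SymMat m) :
    ∃ (U : Matrix (Fin m) (Fin m) ℝ) (x : Fin m → ℝ), U.transpose * U = 1 ∧ symDiag U x = X := by
  have hX : X.1.IsHermitian := by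
    rw [Matrix.IsHermitian, Matrix.conjTranspose_eq_transpose_of_trivial]
    exact X.2
  refine ⟨hX.eigenvectorUnitary, hX.eigenvalues, ?_, ?_⟩
  · have := Unitary.coe_star_mul_self hX.eigenvectorUnitary
    rwa [Matrix.star_eq_conjTranspose, Matrix.conjTranspose_eq_transpose_of_trivial] at this
  · refine Subtype.ext ?_
    conv_rhs => rw [hX.spectral_theorem]
    rw [Unitary.conjStarAlgAut_apply, Matrix.star_eq_conjTranspose,
      Matrix.conjTranspose_eq_transpose_of_trivial]
    rfl

theorem symDiag_add {m : ℕ} {U : Matrix (Fin m) (Fin m) ℝ} (hU : U.transpose * U = 1)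
    (x : Fin m → ℝ) (τ : ℝ) :
    symDiag U x + τ • oneSym m = symDiag U fun i => x i + τ := by
  refine Subtype.ext ?_
  change U * Matrix.diagonal x * U.transpose + τ • (1 : Matrix (Fin m) (Fin m) ℝ) =
    U * Matrix.diagonal (fun i => x i + τ) * U.transpose
  rw [← Matrix.diagonal_add, ← Matrix.smul_one_eq_diagonal, mul_add, add_mul, mul_smul_comm,
    smul_mul_assoc, mul_one, mul_eq_one_comm.1 hU]

/-- Every symmetric `X` lies on an orthogonal slice, and `X + τ` stays on it. There the slice
quotient, evaluated at `x i + τ`, exhibits divisibility in `τ`. -/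
theorem exists_div_det_pow {n N : ℕ} (A : SPD (2 * n) → Forms (2 * n))
    (hA : ∀ (U : Matrix (Fin (2 * n)) (Fin (2 * n)) ℝ) (hU : U.transpose * U = 1),
      (fun σ => A (diagPoint hU σ)) ∈ scaledForms U)
    {Q : SymMat (2 * n) → Forms (2 * n)} (hQ : Q ∈ polynomialForms (2 * n))
    (h : ∀ X : SPD (2 * n), X.mat.det ^ N • A X = Q X.1) :
    ∃ Q' ∈ polynomialForms (2 * n), ∀ X, Q X = X.1.det ^ (N - n) • Q' X := by
  obtain ⟨Q', hQ', hdiv⟩ := exists_div_mod (N - n) hQ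
  refine ⟨Q', hQ', fun X => ?_⟩
  rw [← sub_eq_zero, ← Module.forall_dual_apply_eq_zero_iff ℝ]
  intro l
  obtain ⟨U, x, hU, rfl⟩ := exists_symDiag_eq X
  obtain ⟨P, hP⟩ := exists_eval_symDiag hQ U l
  obtain ⟨G, hG⟩ := scaledForms_bound U (hA U hU) l
  obtain ⟨P', rfl⟩ : (∏ i, MvPolynomial.X i) ^ (N - n) ∣ P := by
    refine prod_X_pow_dvd (G := G) fun σ => ?_
    have h1 := h (diagPoint hU σ)
    have h2 : (diagPoint hU σ).mat.det = (∏ i, σ.1 i) ^ 2 := by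
      rw [← Finset.prod_pow]
      exact det_symDiag hU _
    rw [h2] at h1
    have h3 : l (Q (symDiag U fun i => σ.1 i ^ 2)) =
        ((∏ i, σ.1 i) ^ 2) ^ N * l (A (diagPoint hU σ)) := by
      rw [← smul_eq_mul (a := _ ^ N), ← map_smul, h1]
      rfl
    rw [hP, h3, ← hG, ← pow_mul]
    ring
  obtain ⟨q, r, hr, hq, hq0⟩ := hdiv (symDiag U x) l
  have hpoly : (-(symDiag U x).1).charpoly ^ (N - n) * q + r =
      (-(symDiag U x).1).charpoly ^ (N - n) *
        MvPolynomial.aeval (fun i => Polynomial.C (x i) + Polynomial.X) P' := by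
    refine Polynomial.funext fun τ => ?_
    have he : (MvPolynomial.aeval (fun i => Polynomial.C (x i) + Polynomial.X) P').eval τ =
        MvPolynomial.eval (fun i => x i + τ) P' := by
      rw [← Polynomial.coe_aeval_eq_eval, ← AlgHom.comp_apply, MvPolynomial.comp_aeval,
        ← MvPolynomial.coe_aeval_eq_eval]
      simp
    rw [← hq, symDiag_add hU, ← hP, Polynomial.eval_mul, Polynomial.eval_pow, eval_charpoly_neg,
      symDiag_add hU, det_symDiag hU, he]
    simp
  -- The remainder is a multiple of the divisor of smaller degree.
  have hr0 : r = 0 := by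
    refine Polynomial.eq_zero_of_dvd_of_degree_lt ⟨MvPolynomial.aeval
      (fun i => Polynomial.C (x i) + Polynomial.X) P' - q, ?_⟩ hr
    rw [mul_sub, ← hpoly, add_sub_cancel_left]
  have h0 := hq 0
  rw [hr0, add_zero, Polynomial.eval_mul, Polynomial.eval_pow, eval_charpoly_neg, hq0, zero_smul,
    add_zero] at h0
  rw [map_sub, h0, map_smul, smul_eq_mul, sub_self]

end

end PfaffianForms

theorem theorem2p8 (n : ℕ) (ω : PfaffianForms.CanonicalForms) :
    ∃ Q ∈ PfaffianForms.polynomialForms (2 * n), ∀ X : PfaffianForms.SPD (2 * n),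
      PfaffianForms.realize (2 * n) ω X * PfaffianForms.pfaffianForm n X =
        (X.mat.det ^ ((n : ℝ) + 1 / 2))⁻¹ • Q X.1 := by
  obtain ⟨N, Q, hQ, h⟩ := PfaffianForms.exists_clear n ω
  -- Raising the exponent to `N + n` makes the truncated subtraction exact: `N + n - n = N`.
  obtain ⟨Q', hQ', hdiv⟩ := PfaffianForms.exists_div_det_pow (N := N + n) _
    (fun U hU => PfaffianForms.realize_mul_pfaffian_mem hU ω)
    (PfaffianForms.det_pow_smul_mem _ n hQ) (fun X => by
      rw [add_comm, pow_add, mul_smul, h]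
      rfl)
  refine ⟨Q', hQ', fun X => ?_⟩
  have hd : 0 < X.mat.det := X.2.det_pos
  have h1 : X.mat.det ^ n • (X.mat.det ^ N • (PfaffianForms.realize (2 * n) ω X *
      PfaffianForms.pfaffian n (PfaffianForms.dX (2 * n) * PfaffianForms.const X.mat⁻¹ *
        PfaffianForms.dX (2 * n)))) = X.mat.det ^ N • Q' X.1 := by
    rw [h]
    have := hdiv X.1
    rw [Nat.add_sub_cancel] at this
    exact this
  rw [smul_comm] at h1
  have h2 := smul_right_injective _ (pow_pos hd N).ne' h1
  rw [← h2, PfaffianForms.pfaffianForm, mul_smul_comm, smul_smul]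
  congr 1
  rw [Real.rpow_add hd, Real.rpow_natCast, ← Real.sqrt_eq_rpow, mul_inv, mul_right_comm,
    inv_mul_cancel₀ (pow_pos hd n).ne', one_mul]
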